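/- Let $M$ be a von Neumann algebra with a faithful tracial state $\tau$ (so $M$ is finite), and let $(T_k)_{k\ge 1}$ be a sequence in $M$ which is $*$-free with respect to $\tau$ (that is, the unital $*$-algebras generated by the individual $T_k$ are free) and identically distributed, meaning that $\tau(p(T_j,T_j^*))=\tau(p(T_k,T_k^*))$ for all $j,k$ and all non-commutative polynomials $p\in\mathbb{C}\langle X,Y\rangle$. Put $a_k=|T_k|=(T_k^*T_k)^{1/2}$ and, for $n\ge 1$, $$B_n=T_1^*T_2^*\cdots T_n^*T_n\cdots T_2T_1,\qquad b_n=a_1a_2\cdots a_{n-1}a_n^2a_{n-1}\cdots a_2a_1 .$$ Then for every $n\ge 1$ the operators $B_n$ and $b_n$ are positive (in particular self-adjoint) and have the same distribution with respect to $\tau$, that is, $\tau(p(B_n,B_n^*))=\tau(p(b_n,b_n^*))$ for all $p\in\mathbb{C}\langle X,Y\rangle$. -/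

import Mathlib

noncomputable section

namespace FreeProb

open scoped ComplexOrder

/-- `τ` is a faithful tracial state on the `*`-algebra `M`. A W⋆-algebra which carries such a `τ`
is a finite von Neumann algebra. -/
structure IsFaithfulTracialState {M : Type*} [Ring M] [StarRing M] [Algebra ℂ M]
    (τ : M →ₗ[ℂ] ℂ) : Prop where
  map_one : τ 1 = 1
  nonneg : ∀ x : M, 0 ≤ τ (star x * x)
  faithful : ∀ x : M, τ (star x * x) = 0 → x = 0
  tracial : ∀ x y : M, τ (x * y) = τ (y * x)

/-- Freeness of a family of unital `*`-subalgebras: `τ (x₁ ⋯ x_m) = 0` whenever `m ≥ 1`, each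
`x_j` is a centred element of the algebra with index `i_j`, and neighbouring indices differ.
The word `x₁ ⋯ x_m` is the list of the pairs `(i_j, x_j)`. -/
def IsFree {M : Type*} [Ring M] [StarRing M] [Algebra ℂ M] [StarModule ℂ M] {ι : Type*}
    (τ : M →ₗ[ℂ] ℂ) (A : ι → StarSubalgebra ℂ M) : Prop :=
  ∀ w : List (ι × M), w ≠ [] →
    w.IsChain (fun p q => p.1 ≠ q.1) →
    (∀ p ∈ w, p.2 ∈ A p.1 ∧ τ p.2 = 0) →
    τ ((w.map Prod.snd).prod) = 0

/-- A family of elements is `*`-free if the unital `*`-algebras generated by the individual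
elements are free. -/
def IsStarFree {M : Type*} [Ring M] [StarRing M] [Algebra ℂ M] [StarModule ℂ M] {ι : Type*}
    (τ : M →ₗ[ℂ] ℂ) (T : ι → M) : Prop :=
  IsFree τ (fun k => StarAlgebra.adjoin ℂ {T k})

/-- The value `p(x, x*)` of a non-commutative polynomial `p` in two variables. -/
def starEval {M : Type*} [Ring M] [StarRing M] [Algebra ℂ M]
    (x : M) (p : FreeAlgebra ℂ (Fin 2)) : M :=
  FreeAlgebra.lift ℂ ![x, star x] p

/-- `x` and `y` have the same `*`-distribution: `τ(p(x, x*)) = τ(p(y, y*))` for all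
non-commutative polynomials `p`. -/
def SameStarDistribution {M : Type*} [Ring M] [StarRing M] [Algebra ℂ M]
    (τ : M →ₗ[ℂ] ℂ) (x y : M) : Prop :=
  ∀ p : FreeAlgebra ℂ (Fin 2), τ (starEval x p) = τ (starEval y p)

/-- `x` and `y` are self-adjoint and have the same distribution. -/
def SameDistribution {M : Type*} [Ring M] [StarRing M] [Algebra ℂ M]
    (τ : M →ₗ[ℂ] ℂ) (x y : M) : Prop :=
  IsSelfAdjoint x ∧ IsSelfAdjoint y ∧ SameStarDistribution τ x y

/-- The product `x₁ x₂ ⋯ x_n`, where `x_{k+1}` is written `x k`. -/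
def ascProd {M : Type*} [Monoid M] (x : ℕ → M) : ℕ → M
  | 0 => 1
  | n + 1 => ascProd x n * x n

/-- The product `x_n ⋯ x₂ x₁`, where `x_{k+1}` is written `x k`. -/
def descProd {M : Type*} [Monoid M] (x : ℕ → M) : ℕ → M
  | 0 => 1
  | n + 1 => x n * descProd x n

/-- `B_n = T₁* T₂* ⋯ T_n* T_n ⋯ T₂ T₁`, where `T_{k+1}` is written `T k`. -/
def opB {M : Type*} [Ring M] [StarRing M] (T : ℕ → M) (n : ℕ) : M :=
  ascProd (fun k => star (T k)) n * descProd T n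

/-- `a₁ a₂ ⋯ a_{n-1} a_n² a_{n-1} ⋯ a₂ a₁` for `n ≥ 1`, where `a_{k+1}` is written `a k`
(and the empty product for `n = 0`). -/
def symProd {M : Type*} [Monoid M] (a : ℕ → M) : ℕ → M
  | 0 => 1
  | n + 1 => ascProd a n * a n ^ 2 * descProd a n

/-- `b_n = a₁ a₂ ⋯ a_n² ⋯ a₂ a₁` with `a_k = |T_k| = (T_k* T_k)^{1/2}`. -/
def opb {M : Type*} [CStarAlgebra M] [PartialOrder M] [StarOrderedRing M]
    (T : ℕ → M) (n : ℕ) : M :=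
  symProd (fun k => CFC.abs (T k)) n

end FreeProb

end

/-! Both operators are self-adjoint, so only moments matter. Write `B_n = T₁* C T₁`, where `C`
involves only the later `T_k`. Traciality turns the moments of `B_n` into those of `C · T₁T₁*`, a
product of two free elements, and these depend only on the moments of the two factors. In the same
way `b_n` leads to `c · a₁²`. Traciality also gives `T₁T₁*` and `T₁*T₁ = a₁²` the same moments, and
induction on `n` handles `C` and `c`; this is `apply_nestedProd_pow_eq`. Freeness of `C` from `T₁`
is associativity of freeness (`IsFreeFamily.iSup_fiber`). As `a_k` need only lie in the closed
algebra generated by `T_k`, freeness is first extended to closures. -/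

namespace FreeProb

/-! ### Algebraic freeness and reduced words -/

section Words

variable {M : Type*} [Ring M] [Algebra ℂ M] {ι : Type*}

/-- A word is reduced if its letters are centred elements of the algebras with the given indices
and neighbouring indices differ. -/
structure IsReduced (τ : M →ₗ[ℂ] ℂ) (A : ι → Subalgebra ℂ M) (w : List (ι × M)) : Prop where
  chain : w.IsChain (fun p q => p.1 ≠ q.1)
  letter : ∀ p ∈ w, p.2 ∈ A p.1 ∧ τ p.2 = 0

/-- Freeness of a family of unital subalgebras. -/
def IsFreeFamily (τ : M →ₗ[ℂ] ℂ) (A : ι → Subalgebra ℂ M) : Prop :=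
  ∀ w : List (ι × M), w ≠ [] → IsReduced τ A w → τ (w.map Prod.snd).prod = 0

/-- The linear span of the values of all reduced words, including the empty one. -/
def wordSpan (τ : M →ₗ[ℂ] ℂ) (A : ι → Subalgebra ℂ M) : Submodule ℂ M :=
  Submodule.span ℂ {x | ∃ w : List (ι × M), IsReduced τ A w ∧ (w.map Prod.snd).prod = x}

variable {τ : M →ₗ[ℂ] ℂ} {A : ι → Subalgebra ℂ M}

theorem IsReduced.nil : IsReduced τ A [] := ⟨by simp, by simp⟩

theorem IsReduced.tail {p : ι × M} {w : List (ι × M)} (h : IsReduced τ A (p :: w)) :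
    IsReduced τ A w :=
  ⟨h.chain.tail, fun q hq => h.letter q (List.mem_cons_of_mem _ hq)⟩

theorem IsReduced.cons {i : ι} {x : M} {w : List (ι × M)} (h : IsReduced τ A w)
    (hx : x ∈ A i) (hx0 : τ x = 0) (hi : ∀ q ∈ w.head?, i ≠ q.1) :
    IsReduced τ A ((i, x) :: w) := by
  refine ⟨List.isChain_cons.2 ⟨hi, h.chain⟩, ?_⟩
  intro p hp
  rcases List.mem_cons.1 hp with rfl | hp
  · exact ⟨hx, hx0⟩
  · exact h.letter p hp

theorem IsReduced.mapIndex {κ : Type*} {f : κ → ι} (hf : Function.Injective f)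
    {w : List (κ × M)} (h : IsReduced τ (fun k => A (f k)) w) :
    IsReduced τ A (w.map (Prod.map f id)) := by
  refine ⟨?_, ?_⟩
  · rw [List.isChain_map]
    exact h.chain.imp fun p q hpq => fun h' => hpq (hf h')
  · intro p hp
    obtain ⟨q, hq, rfl⟩ := List.mem_map.1 hp
    exact h.letter q hq

theorem IsFreeFamily.comp_injective {κ : Type*} {f : κ → ι} (hA : IsFreeFamily τ A)
    (hf : Function.Injective f) : IsFreeFamily τ (fun k => A (f k)) := by
  intro w hw h
  have := hA _ (by simpa using hw) (h.mapIndex hf)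
  simpa [Function.comp_def] using this

theorem prod_mem_wordSpan {w : List (ι × M)} (h : IsReduced τ A w) :
    (w.map Prod.snd).prod ∈ wordSpan τ A :=
  Submodule.subset_span ⟨w, h, rfl⟩

theorem one_mem_wordSpan : (1 : M) ∈ wordSpan τ A := by
  simpa using prod_mem_wordSpan (τ := τ) (A := A) IsReduced.nil

/-- A reduced word may be multiplied by any letter whose index differs from that of its head. -/
theorem mul_prod_mem_wordSpan_of_ne (h1 : τ 1 = 1) {i : ι} {x : M} {w : List (ι × M)}
    (h : IsReduced τ A w) (hx : x ∈ A i) (hi : ∀ q ∈ w.head?, i ≠ q.1) :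
    x * (w.map Prod.snd).prod ∈ wordSpan τ A := by
  have hc : (x - τ x • 1) * (w.map Prod.snd).prod ∈ wordSpan τ A := by
    have := prod_mem_wordSpan (h.cons (x := x - τ x • 1) (i := i)
      (sub_mem hx ((A i).smul_mem (one_mem _) _)) (by simp [h1]) hi)
    simpa using this
  have := add_mem hc ((wordSpan τ A).smul_mem (τ x) (prod_mem_wordSpan h))
  simpa [sub_mul] using this

theorem mul_mem_wordSpan (h1 : τ 1 = 1) {i : ι} {x z : M} (hx : x ∈ A i)
    (hz : z ∈ wordSpan τ A) : x * z ∈ wordSpan τ A := by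
  refine Submodule.span_induction (p := fun z _ => x * z ∈ wordSpan τ A) ?_ (by simp)
    (fun y z _ _ hy hz => by rw [mul_add]; exact add_mem hy hz)
    (fun c y _ hy => by rw [mul_smul_comm]; exact Submodule.smul_mem _ _ hy) hz
  rintro _ ⟨w, hw, rfl⟩
  rcases w with _ | ⟨⟨j, y⟩, w⟩
  · exact mul_prod_mem_wordSpan_of_ne h1 hw hx (by simp)
  -- With equal indices, `x` is absorbed into the head letter, and the merged letter is centred
  -- again.
  · by_cases hij : i = j
    · subst hij
      have hy : y ∈ A i := (hw.letter (i, y) (by simp)).1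
      have := mul_prod_mem_wordSpan_of_ne h1 hw.tail (mul_mem hx hy)
        (List.isChain_cons.1 hw.chain).1
      simpa [mul_assoc] using this
    · exact mul_prod_mem_wordSpan_of_ne h1 hw hx (by simpa using hij)

/-- The algebra generated by a family of subalgebras is spanned by the reduced words. -/
theorem iSup_le_wordSpan (h1 : τ 1 = 1) {x : M} (hx : x ∈ ⨆ i, A i) : x ∈ wordSpan τ A := by
  -- The left multipliers of the span form an algebra containing every `A i`; applying one to `1`
  -- recovers it.
  let L : Subalgebra ℂ M :=
    { carrier := {y | ∀ z ∈ wordSpan τ A, y * z ∈ wordSpan τ A}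
      mul_mem' := fun {a b} ha hb z hz => by rw [mul_assoc]; exact ha _ (hb _ hz)
      add_mem' := fun {a b} ha hb z hz => by rw [add_mul]; exact add_mem (ha _ hz) (hb _ hz)
      algebraMap_mem' := fun c z hz => by
        rw [← Algebra.smul_def]; exact Submodule.smul_mem _ _ hz }
  have hL : ⨆ i, A i ≤ L := iSup_le fun i y hy z hz => mul_mem_wordSpan h1 hy hz
  simpa using hL hx 1 one_mem_wordSpan

/-- In a free family, centring an element of the generated algebra removes the empty word. -/
theorem IsFreeFamily.sub_mem_span (hA : IsFreeFamily τ A) (h1 : τ 1 = 1) {x : M}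
    (hx : x ∈ wordSpan τ A) :
    x - τ x • 1 ∈ Submodule.span ℂ
      {x | ∃ w : List (ι × M), w ≠ [] ∧ IsReduced τ A w ∧ (w.map Prod.snd).prod = x} := by
  refine Submodule.span_induction (p := fun x _ => x - τ x • 1 ∈ Submodule.span ℂ
      {x | ∃ w : List (ι × M), w ≠ [] ∧ IsReduced τ A w ∧ (w.map Prod.snd).prod = x})
    ?_ (by simp) ?_ ?_ hx
  · rintro _ ⟨w, hw, rfl⟩
    by_cases hw0 : w = []
    · simp [hw0, h1]
    · rw [hA w hw0 hw, zero_smul, sub_zero]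
      exact Submodule.subset_span ⟨w, hw0, hw, rfl⟩
  · intro y z _ _ hy hz
    have := add_mem hy hz
    rwa [sub_add_sub_comm, ← add_smul, ← map_add] at this
  · intro c y _ hy
    have := Submodule.smul_mem _ c hy
    rwa [smul_sub, smul_smul, ← smul_eq_mul, ← map_smul] at this

/-- Associativity of freeness: grouping the members of a free family gives a free family. -/
theorem IsFreeFamily.iSup_fiber {κ : Type*} (hA : IsFreeFamily τ A) (h1 : τ 1 = 1) (g : ι → κ) :
    IsFreeFamily τ (fun k => ⨆ i : {i // g i = k}, A i) := by
  let S : κ → Set M := fun k => {x | ∃ v : List (ι × M), v ≠ [] ∧ IsReduced τ A v ∧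
    (∀ l ∈ v, g l.1 = k) ∧ (v.map Prod.snd).prod = x}
  -- Only the group of the head letter is recorded: that is all that prepending a block from another
  -- group requires.
  let R : κ → Set M := fun k => {x | ∃ v : List (ι × M), v ≠ [] ∧ IsReduced τ A v ∧
    (∀ l ∈ v.head?, g l.1 = k) ∧ (v.map Prod.snd).prod = x}
  have hSR : ∀ k, S k ⊆ R k := by
    rintro k _ ⟨v, hv0, hv, hvk, rfl⟩
    exact ⟨v, hv0, hv, fun l hl => hvk l (List.mem_of_mem_head? hl), rfl⟩
  have hS : ∀ k x, x ∈ (⨆ i : {i // g i = k}, A i) → τ x = 0 → x ∈ Submodule.span ℂ (S k) := by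
    intro k x hx hx0
    have hfree : IsFreeFamily τ (fun i : {i // g i = k} => A i) :=
      hA.comp_injective Subtype.val_injective
    have := hfree.sub_mem_span h1 (iSup_le_wordSpan h1 hx)
    rw [hx0, zero_smul, sub_zero] at this
    refine Submodule.span_mono ?_ this
    rintro _ ⟨w, hw0, hw, rfl⟩
    refine ⟨w.map (Prod.map Subtype.val id), by simpa using hw0,
      hw.mapIndex Subtype.val_injective, ?_, by simp [Function.comp_def]⟩
    intro l hl
    obtain ⟨q, -, rfl⟩ := List.mem_map.1 hl
    exact q.1.2
  have key : ∀ (w : List (κ × M)) (p : κ × M),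
      IsReduced τ (fun k => ⨆ i : {i // g i = k}, A i) (p :: w) →
      ((p :: w).map Prod.snd).prod ∈ Submodule.span ℂ (R p.1) := by
    intro w
    induction w with
    | nil =>
      intro p hp
      have := hp.letter p (by simp)
      simpa using Submodule.span_mono (hSR _) (hS _ _ this.1 this.2)
    | cons q w ih =>
      intro p hp
      have hpp := hp.letter p (by simp)
      have hq := ih q hp.tail
      have hpq : p.1 ≠ q.1 := (List.isChain_cons.1 hp.chain).1 q (by simp)
      have := Submodule.mul_mem_mul (hS _ _ hpp.1 hpp.2) hq
      rw [Submodule.span_mul_span] at this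
      rw [List.map_cons, List.prod_cons]
      refine Submodule.span_mono ?_ this
      rintro _ ⟨_, ⟨v, hv0, hv, hvk, rfl⟩, _, ⟨u, hu0, hu, huk, rfl⟩, rfl⟩
      refine ⟨v ++ u, by simp [hv0], ⟨?_, ?_⟩, ?_, by simp⟩
      · refine List.isChain_append.2 ⟨hv.chain, hu.chain, fun a ha b hb hab => hpq ?_⟩
        rw [← hvk a (List.mem_of_getLast? ha), ← huk b hb, hab]
      · intro l hl
        rcases List.mem_append.1 hl with hl | hl
        · exact hv.letter l hl
        · exact hu.letter l hl
      · intro l hl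
        rw [List.head?_append_of_ne_nil _ hv0] at hl
        exact hvk l (List.mem_of_mem_head? hl)
  intro w hw0 hw
  obtain ⟨p, w, rfl⟩ := List.exists_cons_of_ne_nil hw0
  refine Submodule.span_induction (p := fun x _ => τ x = 0) ?_ (map_zero _)
    (fun x y _ _ hx hy => by rw [map_add, hx, hy, add_zero])
    (fun c x _ hx => by rw [map_smul, hx, smul_zero]) (key w p hw)
  rintro _ ⟨v, hv0, hv, -, rfl⟩
  exact hA v hv0 hv

/-- The joint distribution of a free family is determined by the individual distributions. The
correspondence between the two families is recorded by subalgebras of `M × M`. -/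
theorem IsFreeFamily.apply_fst_eq_apply_snd {B : ι → Subalgebra ℂ M} (hA : IsFreeFamily τ A)
    (hB : IsFreeFamily τ B) (h1 : τ 1 = 1) {D : ι → Subalgebra ℂ (M × M)}
    (hD : ∀ i, ∀ x ∈ D i, x.1 ∈ A i ∧ x.2 ∈ B i ∧ τ x.1 = τ x.2) {x : M × M}
    (hx : x ∈ ⨆ i, D i) : τ x.1 = τ x.2 := by
  -- Centring by the first coordinate centres both, since `τ` agrees on the two coordinates of each
  -- `D i`.
  have hx' := iSup_le_wordSpan (τ := τ ∘ₗ LinearMap.fst ℂ M M) (by simpa using h1) hx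
  refine Submodule.span_induction (p := fun x _ => τ x.1 = τ x.2) ?_ (by simp)
    (fun x y _ _ hx hy => by simp [hx, hy]) (fun c x _ hx => by simp [hx]) hx'
  rintro _ ⟨w, hw, rfl⟩
  by_cases hw0 : w = []
  · simp [hw0]
  have hfst : IsReduced τ A (w.map (Prod.map id Prod.fst)) := by
    refine ⟨by rw [List.isChain_map]; exact hw.chain, fun p hp => ?_⟩
    obtain ⟨q, hq, rfl⟩ := List.mem_map.1 hp
    have := hw.letter q hq
    exact ⟨(hD _ _ this.1).1, this.2⟩
  have hsnd : IsReduced τ B (w.map (Prod.map id Prod.snd)) := by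
    refine ⟨by rw [List.isChain_map]; exact hw.chain, fun p hp => ?_⟩
    obtain ⟨q, hq, rfl⟩ := List.mem_map.1 hp
    have := hw.letter q hq
    exact ⟨(hD _ _ this.1).2.1, (hD _ _ this.1).2.2.symm.trans this.2⟩
  have e1 := hA _ (by simpa using hw0) hfst
  have e2 := hB _ (by simpa using hw0) hsnd
  have p1 : ((w.map Prod.snd).prod).1 = ((w.map (Prod.map id Prod.fst)).map Prod.snd).prod := by
    rw [← RingHom.coe_fst, map_list_prod]; simp [Function.comp_def]
  have p2 : ((w.map Prod.snd).prod).2 = ((w.map (Prod.map id Prod.snd)).map Prod.snd).prod := by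
    rw [← RingHom.coe_snd, map_list_prod]; simp [Function.comp_def]
  rw [p1, p2, e1, e2]

/-- Two elements with the same moments have the same values on all polynomials. -/
theorem apply_aeval_eq {x y : M} (h : ∀ m : ℕ, τ (x ^ m) = τ (y ^ m)) (p : Polynomial ℂ) :
    τ (Polynomial.aeval x p) = τ (Polynomial.aeval y p) := by
  have : τ ∘ₗ (Polynomial.aeval x).toLinearMap = τ ∘ₗ (Polynomial.aeval y).toLinearMap := by
    ext m
    simpa using h m
  exact congrArg (fun f => f p) this

/-- The moments of a product of two free elements are determined by the moments of the
factors. -/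
theorem IsFreeFamily.apply_mul_pow_eq {A : Bool → Subalgebra ℂ M} (hA : IsFreeFamily τ A)
    (h1 : τ 1 = 1) {x x' y y' : M} (hx : x ∈ A true) (hx' : x' ∈ A true) (hy : y ∈ A false)
    (hy' : y' ∈ A false) (hxx : ∀ m : ℕ, τ (x ^ m) = τ (x' ^ m))
    (hyy : ∀ m : ℕ, τ (y ^ m) = τ (y' ^ m)) (m : ℕ) :
    τ ((x * y) ^ m) = τ ((x' * y') ^ m) := by
  let z : Bool → M × M := fun b => cond b (x, x') (y, y')
  -- Its elements are the pairs `(p(x), p(x'))`, respectively `(p(y), p(y'))`.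
  let D : Bool → Subalgebra ℂ (M × M) := fun b => Algebra.adjoin ℂ {z b}
  have hz : ∀ b, z b ∈ ⨆ b, D b := fun b =>
    le_iSup D b (Algebra.subset_adjoin (Set.mem_singleton _))
  have hD : ∀ b, ∀ u ∈ D b, u.1 ∈ A b ∧ u.2 ∈ A b ∧ τ u.1 = τ u.2 := by
    intro b u hu
    have hu' : u ∈ Algebra.adjoin ℂ {z b} := hu
    rw [Algebra.adjoin_singleton_eq_range_aeval] at hu'
    obtain ⟨p, rfl⟩ := hu'
    have e1 : (Polynomial.aeval (z b) p).1 = Polynomial.aeval (z b).1 p :=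
      (Polynomial.aeval_algHom_apply (AlgHom.fst ℂ M M) (z b) p).symm
    have e2 : (Polynomial.aeval (z b) p).2 = Polynomial.aeval (z b).2 p :=
      (Polynomial.aeval_algHom_apply (AlgHom.snd ℂ M M) (z b) p).symm
    have hmem : ∀ v ∈ A b, Polynomial.aeval v p ∈ A b := fun v hv =>
      Algebra.adjoin_le (Set.singleton_subset_iff.2 hv)
        (Polynomial.aeval_mem_adjoin_singleton ℂ v)
    refine ⟨?_, ?_, ?_⟩
    · change (Polynomial.aeval (z b) p).1 ∈ _
      rw [e1]
      exact hmem _ (by cases b <;> assumption)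
    · change (Polynomial.aeval (z b) p).2 ∈ _
      rw [e2]
      exact hmem _ (by cases b <;> assumption)
    · change τ (Polynomial.aeval (z b) p).1 = τ (Polynomial.aeval (z b) p).2
      rw [e1, e2]
      exact apply_aeval_eq (by cases b <;> assumption) p
  exact hA.apply_fst_eq_apply_snd hA h1 hD (pow_mem (mul_mem (hz true) (hz false)) m)

theorem apply_mul_pow_comm (hτ : ∀ x y : M, τ (x * y) = τ (y * x)) (x y : M) (m : ℕ) :
    τ ((x * y) ^ m) = τ ((y * x) ^ m) := by
  cases m with
  | zero => simp
  | succ m =>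
    have h : SemiconjBy x (y * x) (x * y) := by simp [SemiconjBy, mul_assoc]
    rw [pow_succ, ← mul_assoc, ← (h.pow_right m).eq, mul_assoc, hτ, mul_assoc, ← pow_succ]

theorem ascProd_succ' {M : Type*} [Monoid M] (x : ℕ → M) (n : ℕ) :
    ascProd x (n + 1) = x 0 * ascProd (fun k => x (k + 1)) n := by
  induction n with
  | zero => simp [ascProd]
  | succ n ih => rw [ascProd, ih, ascProd, mul_assoc]

theorem descProd_succ' {M : Type*} [Monoid M] (x : ℕ → M) (n : ℕ) :
    descProd x (n + 1) = descProd (fun k => x (k + 1)) n * x 0 := by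
  induction n with
  | zero => simp [descProd]
  | succ n ih => rw [descProd, ih, descProd, mul_assoc]

theorem ascProd_mem {S : Subalgebra ℂ M} {x : ℕ → M} (hx : ∀ k, x k ∈ S) (n : ℕ) :
    ascProd x n ∈ S := by
  induction n with
  | zero => exact one_mem S
  | succ n ih => exact mul_mem ih (hx n)

theorem descProd_mem {S : Subalgebra ℂ M} {x : ℕ → M} (hx : ∀ k, x k ∈ S) (n : ℕ) :
    descProd x n ∈ S := by
  induction n with
  | zero => exact one_mem S
  | succ n ih => exact mul_mem (hx n) ih

/-- If `t k * s k` and `c k * a k` have the same moments and lie in the `k`-th member of a free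
family, then the nested products `s₁ ⋯ s_n t_n ⋯ t₁` and `a₁ ⋯ a_n c_n ⋯ c₁` have the same
moments. -/
theorem apply_nestedProd_pow_eq (h1 : τ 1 = 1) (hτ : ∀ x y : M, τ (x * y) = τ (y * x)) (n : ℕ) :
    ∀ {A : ℕ → Subalgebra ℂ M} {s t a c : ℕ → M}, IsFreeFamily τ A → (∀ k, s k ∈ A k) →
      (∀ k, t k ∈ A k) → (∀ k, a k ∈ A k) → (∀ k, c k ∈ A k) →
      (∀ k m, τ ((t k * s k) ^ m) = τ ((c k * a k) ^ m)) →
      ∀ m : ℕ, τ ((ascProd s n * descProd t n) ^ m) = τ ((ascProd a n * descProd c n) ^ m) := by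
  induction n with
  | zero => intros; simp [ascProd, descProd]
  | succ n ih =>
    intro A s t a c hA hs ht ha hc hm m
    -- Separates the outermost index from all the others.
    let g : ℕ → Bool := fun k => decide (k ≠ 0)
    have hG := hA.iSup_fiber h1 g
    have hle0 : ∀ {x}, x ∈ A 0 → x ∈ ⨆ i : {i // g i = false}, A i := fun {x} hx =>
      le_iSup (fun i : {i // g i = false} => A i) ⟨0, by simp [g]⟩ hx
    have hle : ∀ k {x}, x ∈ A (k + 1) → x ∈ ⨆ i : {i // g i = true}, A i := fun k {x} hx =>
      le_iSup (fun i : {i // g i = true} => A i) ⟨k + 1, by simp [g]⟩ hx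
    have ih' := ih (hA.comp_injective (f := fun k => k + 1) (add_left_injective 1))
      (fun k => hs (k + 1)) (fun k => ht (k + 1)) (fun k => ha (k + 1)) (fun k => hc (k + 1))
      (fun k => hm (k + 1))
    have rot : ∀ u v : ℕ → M, τ ((ascProd u (n + 1) * descProd v (n + 1)) ^ m) =
        τ (((ascProd (fun k => u (k + 1)) n * descProd (fun k => v (k + 1)) n) *
          (v 0 * u 0)) ^ m) := by
      intro u v
      rw [ascProd_succ', descProd_succ', mul_assoc, apply_mul_pow_comm hτ]
      simp only [mul_assoc]
    rw [rot, rot]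
    exact hG.apply_mul_pow_eq h1
      (mul_mem (ascProd_mem (fun k => hle k (hs _)) n) (descProd_mem (fun k => hle k (ht _)) n))
      (mul_mem (ascProd_mem (fun k => hle k (ha _)) n) (descProd_mem (fun k => hle k (hc _)) n))
      (hle0 (mul_mem (ht 0) (hs 0))) (hle0 (mul_mem (hc 0) (ha 0))) ih' (hm 0) m

end Words

/-! ### Passage to norm closures -/

section Closure

variable {M : Type*} [NormedRing M] [NormedAlgebra ℂ M] {ι : Type*} {τ : M →ₗ[ℂ] ℂ}

/-- Freeness passes to the closures of the subalgebras if the functional is continuous. -/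
theorem IsFreeFamily.topologicalClosure {A : ι → Subalgebra ℂ M} (hA : IsFreeFamily τ A)
    (h1 : τ 1 = 1) (hτ : Continuous τ) :
    IsFreeFamily τ (fun i => (A i).topologicalClosure) := by
  -- Letters of the closures are replaced one at a time: `u` already lies in the algebras, `v` is
  -- still to be treated.
  have key : ∀ v u : List (ι × M), u ++ v ≠ [] →
      (u ++ v).IsChain (fun p q => p.1 ≠ q.1) →
      (∀ p ∈ u, p.2 ∈ A p.1 ∧ τ p.2 = 0) →
      (∀ p ∈ v, p.2 ∈ (A p.1).topologicalClosure ∧ τ p.2 = 0) →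
      τ ((u ++ v).map Prod.snd).prod = 0 := by
    intro v
    induction v with
    | nil =>
      intro u h0 hc hu _
      rw [List.append_nil] at *
      exact hA u h0 ⟨hc, hu⟩
    | cons p v ih =>
      intro u _ hc hu hv
      have hp := hv p (by simp)
      -- Approximants of `p.2` need not be centred, so the centring is built into `F`.
      let F : M → ℂ := fun y => τ ((u.map Prod.snd).prod * ((y - τ y • 1) * (v.map Prod.snd).prod))
      have hF : Continuous F := by
        refine hτ.comp ?_
        fun_prop
      have hFA : ∀ y ∈ (A p.1 : Set M), F y = 0 := by
        intro y hy
        have := ih (u ++ [(p.1, y - τ y • 1)]) (by simp) ?_ ?_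
          (fun q hq => hv q (List.mem_cons_of_mem _ hq))
        · simpa [F, mul_assoc] using this
        · have hc' := (List.isChain_map (f := Prod.fst) (R := fun i j : ι => i ≠ j)).2 hc
          refine (List.isChain_map (f := Prod.fst) (R := fun i j : ι => i ≠ j)).1 ?_
          simpa using hc'
        · intro q hq
          rcases List.mem_append.1 hq with hq | hq
          · exact hu q hq
          · obtain rfl := List.mem_singleton.1 hq
            exact ⟨sub_mem hy ((A p.1).smul_mem (one_mem _) _), by simp [h1]⟩
      have hmem : p.2 ∈ closure (A p.1 : Set M) := hp.1
      have : F p.2 = 0 :=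
        closure_minimal (t := {y | F y = 0}) hFA (isClosed_eq hF continuous_const) hmem
      simpa [F, hp.2] using this
  intro w hw0 hw
  exact key w [] hw0 hw.chain (by simp) hw.letter

end Closure

theorem star_descProd {M : Type*} [Ring M] [StarRing M] (x : ℕ → M) (n : ℕ) :
    star (descProd x n) = ascProd (fun k => star (x k)) n := by
  induction n with
  | zero => simp [ascProd, descProd]
  | succ n ih => rw [descProd, star_mul, ih, ascProd]

theorem symProd_eq {M : Type*} [Monoid M] (a : ℕ → M) {n : ℕ} (hn : 1 ≤ n) :
    symProd a n = ascProd a n * descProd a n := by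
  obtain ⟨n, rfl⟩ := Nat.exists_eq_add_of_le' hn
  simp only [symProd, ascProd, descProd, sq, mul_assoc]

theorem sameDistribution_of_moments {M : Type*} [Ring M] [StarRing M] [Algebra ℂ M]
    {τ : M →ₗ[ℂ] ℂ} {x y : M} (hx : IsSelfAdjoint x) (hy : IsSelfAdjoint y)
    (h : ∀ m : ℕ, τ (x ^ m) = τ (y ^ m)) : SameDistribution τ x y := by
  have key : ∀ z : M, IsSelfAdjoint z → ∀ p : FreeAlgebra ℂ (Fin 2),
      starEval z p =
        Polynomial.aeval z (FreeAlgebra.lift ℂ (fun _ => (Polynomial.X : Polynomial ℂ)) p) := by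
    intro z hz p
    have : FreeAlgebra.lift ℂ ![z, star z] =
        (Polynomial.aeval z).comp
          (FreeAlgebra.lift ℂ (fun _ : Fin 2 => (Polynomial.X : Polynomial ℂ))) := by
      ext i
      fin_cases i <;> simp [hz.star_eq]
    exact congrArg (fun f => f p) this
  refine ⟨hx, hy, fun p => ?_⟩
  rw [key x hx, key y hy]
  exact apply_aeval_eq h _

/-! ### Continuity of the trace and the absolute value -/

section CStar

variable {M : Type*} [CStarAlgebra M] [PartialOrder M] [StarOrderedRing M]

open scoped ComplexOrder in
theorem IsFaithfulTracialState.continuous {τ : M →ₗ[ℂ] ℂ} (hτ : IsFaithfulTracialState τ) :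
    Continuous τ := by
  let f : M →ₚ[ℂ] ℂ := PositiveLinearMap.mk₀ τ fun x hx => by
    obtain ⟨y, rfl⟩ := CStarAlgebra.nonneg_iff_eq_star_mul_self.1 hx
    exact hτ.nonneg y
  exact map_continuous f

theorem abs_mem_elemental (x : M) : CFC.abs x ∈ StarAlgebra.elemental ℂ x := by
  have h0 : 0 ≤ star x * x := star_mul_self_nonneg x
  have hle : StarAlgebra.elemental ℂ (star x * x) ≤ StarAlgebra.elemental ℂ x :=
    StarAlgebra.elemental.le_of_mem (StarAlgebra.elemental.isClosed ℂ x)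
      (mul_mem (star_mem (StarAlgebra.elemental.self_mem ℂ x))
        (StarAlgebra.elemental.self_mem ℂ x))
  rw [CFC.abs, CFC.sqrt_eq_real_sqrt _ h0, cfcₙ_eq_cfc, cfc_real_eq_complex]
  exact hle (cfc_mem_elemental _ _)

end CStar

end FreeProb

theorem lemma3p1 {M : Type*} [CStarAlgebra M] [WStarAlgebra M] [PartialOrder M]
    [StarOrderedRing M] (τ : M →ₗ[ℂ] ℂ) (hτ : FreeProb.IsFaithfulTracialState τ)
    (T : ℕ → M) (hfree : FreeProb.IsStarFree τ T)
    (hid : ∀ j k : ℕ, FreeProb.SameStarDistribution τ (T j) (T k))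
    (n : ℕ) (hn : 1 ≤ n) :
    0 ≤ FreeProb.opB T n ∧ 0 ≤ FreeProb.opb T n ∧
      FreeProb.SameDistribution τ (FreeProb.opB T n) (FreeProb.opb T n) := by
  have hB : 0 ≤ FreeProb.opB T n := by
    rw [FreeProb.opB, ← FreeProb.star_descProd]
    exact star_mul_self_nonneg _
  have hsa : ∀ k, star (CFC.abs (T k)) = CFC.abs (T k) := fun k =>
    (IsSelfAdjoint.of_nonneg (CFC.abs_nonneg (T k))).star_eq
  have hb_eq : FreeProb.opb T n =
      FreeProb.ascProd (fun k => CFC.abs (T k)) n * FreeProb.descProd (fun k => CFC.abs (T k)) n :=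
    FreeProb.symProd_eq _ hn
  have hb : 0 ≤ FreeProb.opb T n := by
    have := star_mul_self_nonneg (FreeProb.descProd (fun k => CFC.abs (T k)) n)
    rw [FreeProb.star_descProd] at this
    simpa only [hsa, ← hb_eq] using this
  refine ⟨hB, hb, FreeProb.sameDistribution_of_moments (.of_nonneg hB) (.of_nonneg hb) ?_⟩
  have hA : FreeProb.IsFreeFamily τ (fun k => (StarAlgebra.adjoin ℂ {T k}).toSubalgebra) :=
    fun w hw0 hw => hfree w hw0 hw.chain hw.letter
  have hcl := hA.topologicalClosure hτ.map_one hτ.continuous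
  have hT : ∀ k, T k ∈ StarAlgebra.elemental ℂ (T k) := fun k => StarAlgebra.elemental.self_mem ℂ _
  rw [hb_eq]
  exact FreeProb.apply_nestedProd_pow_eq hτ.map_one hτ.tracial n hcl
    (fun k => (star_mem (hT k) : star (T k) ∈ StarAlgebra.elemental ℂ (T k))) hT
    (fun k => FreeProb.abs_mem_elemental (T k))
    (fun k => FreeProb.abs_mem_elemental (T k)) fun k m => by
      -- The factors here are `T_k T_k*` and `a_k² = T_k* T_k`.
      rw [FreeProb.apply_mul_pow_comm hτ.tracial, CFC.abs_mul_abs]
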